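/- Let $R$ be a commutative integral domain with identity that contains the field of rational numbers $\mathbb{Q}=\mathbb{Q}\cdot 1\subseteq R$ and is radically Noetherian, i.e. satisfies the ascending chain condition for radical ideals (an ideal $I$ is radical if $f^k\in I$ with $k\ge 1$ implies $f\in I$). For a natural number $m$ let $P_m$ be the symplectic Poisson algebra of index $m$ over $R$, i.e. the polynomial algebra $R[x_1,\ldots,x_{2m}]$ with its usual product and with the Poisson bracket $$\{f,g\}=\sum_{i=1}^m\left(\frac{\partial f}{\partial x_{2i-1}}\frac{\partial g}{\partial x_{2i}}-\frac{\partial f}{\partial x_{2i}}\frac{\partial g}{\partial x_{2i-1}}\right).$$ Then the Poisson algebra $P_m$ is equationally Noetherian. Here an algebra $A$ with a zero element $0$ is called equationally Noetherian if the following holds for every variety $\mathfrak{M}$ of algebras of the signature of $A$ (for $P_m$: zero, negation, addition, multiplication by the scalars from $R$, product and bracket) with $A\in\mathfrak{M}$, and for every natural $n$. Let $B=A\sqcup_{\mathfrak{M}}\mathfrak{M}\langle y_1,\ldots,y_n\rangle$ be the coproduct in $\mathfrak{M}$ of $A$ and the free algebra of $\mathfrak{M}$ on $y_1,\ldots,y_n$.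 For $f\in B$ and $(a_1,\ldots,a_n)\in A^n$ let $f(a_1,\ldots,a_n)\in A$ be the image of $f$ under the unique homomorphism $B\to A$ that is the identity on $A$ and sends $y_i$ to $a_i$ for all $i$; for $S\subseteq B$ put $Z(S)=\{(a_1,\ldots,a_n)\in A^n : f(a_1,\ldots,a_n)=0 \text{ for all } f\in S\}$. Then $A^n$ is a Noetherian topological space in the Zariski topology, i.e. the coarsest topology in which all sets $Z(S)$, $S\subseteq B$, are closed. -/

import Mathlib

/-! ## Varieties of algebras, free algebras and coproducts

An algebraic signature is a first-order language `L` without relation symbols, and a universal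
algebra of that signature is an `L`-structure. An identity is a pair of terms in countably many
variables, and a set `E` of identities stands for the variety of all algebras satisfying `E`. -/

namespace EqNoeth

open FirstOrder FirstOrder.Language FirstOrder.Language.Structure

universe u v w

/-- Identities `s ≈ t` of the signature `L`, in countably many variables. -/
abbrev Identity (L : FirstOrder.Language.{u, v}) := L.Term ℕ × L.Term ℕ

/-- `A` belongs to the variety defined by the set of identities `E`. -/
def InVariety {L : FirstOrder.Language.{u, v}} (E : Set (Identity L)) (A : Type*) [L.Structure A] : Prop :=
  ∀ p ∈ E, ∀ x : ℕ → A, p.1.realize x = p.2.realize x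

section Presented

set_option linter.unusedSectionVars false

variable {L : FirstOrder.Language.{u, v}} [L.IsAlgebraic] (E : Set (Identity L))

/-- The least congruence on the term algebra `L.Term X` that contains all substitution instances
of the identities in `E` and the defining relations `rel`. -/
inductive PresCong {X : Type w} (rel : L.Term X → L.Term X → Prop) :
    L.Term X → L.Term X → Prop
  | of_rel {s t : L.Term X} (h : rel s t) : PresCong rel s t
  | of_identity {p : Identity L} (hp : p ∈ E) (σ : ℕ → L.Term X) :
      PresCong rel (p.1.subst σ) (p.2.subst σ)
  | refl (t : L.Term X) : PresCong rel t t
  | symm {s t : L.Term X} (h : PresCong rel s t) : PresCong rel t s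
  | trans {r s t : L.Term X} (h₁ : PresCong rel r s) (h₂ : PresCong rel s t) : PresCong rel r t
  | func {n : ℕ} (f : L.Functions n) {s t : Fin n → L.Term X}
      (h : ∀ i, PresCong rel (s i) (t i)) : PresCong rel (Term.func f s) (Term.func f t)

/-- `PresCong` as a setoid. -/
def presSetoid {X : Type w} (rel : L.Term X → L.Term X → Prop) : Setoid (L.Term X) where
  r := PresCong E rel
  iseqv := ⟨PresCong.refl, PresCong.symm, PresCong.trans⟩

/-- The term algebra on `X`. -/
@[reducible] def termStructure (X : Type w) : L.Structure (L.Term X) where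
  funMap f ts := Term.func f ts
  RelMap r _ := isEmptyElim r

instance presPrestructure {X : Type w} (rel : L.Term X → L.Term X → Prop) :
    L.Prestructure (presSetoid E rel) where
  toStructure := termStructure X
  fun_equiv _ _ h := PresCong.func _ h
  rel_equiv {_} {r} := isEmptyElim r

/-- The algebra of the variety defined by `E` with generators `X` and defining relations `rel`. -/
def Presented {X : Type w} (rel : L.Term X → L.Term X → Prop) : Type (max u w) :=
  Quotient (presSetoid E rel)

noncomputable instance {X : Type w} (rel : L.Term X → L.Term X → Prop) :
    L.Structure (Presented E rel) :=
  inferInstanceAs (L.Structure (Quotient (presSetoid E rel)))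

variable {E}

namespace Presented

variable {X : Type w} {rel : L.Term X → L.Term X → Prop}

/-- The class of a term. -/
def mk (t : L.Term X) : Presented E rel := Quotient.mk (presSetoid E rel) t

theorem funMap_mk {n : ℕ} (f : L.Functions n) (ts : Fin n → L.Term X) :
    funMap f (fun i => (mk (ts i) : Presented E rel)) = mk (Term.func f ts) :=
  funMap_quotient_mk' (presSetoid E rel) f ts

theorem mk_surjective : Function.Surjective (mk : L.Term X → Presented E rel) :=
  Quotient.mk_surjective

theorem realize_mk {Y : Type*} (t : L.Term Y) (σ : Y → L.Term X) :
    (t.realize fun y => (mk (σ y) : Presented E rel)) = mk (t.subst σ) := by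
  induction t with
  | var => rfl
  | func f ts ih => simp only [Term.realize_func, ih, funMap_mk, Term.subst]

theorem inVariety : InVariety E (Presented E rel) := by
  intro p hp x
  choose σ hσ using fun i => mk_surjective (x i)
  obtain rfl : (fun i => mk (σ i)) = x := funext hσ
  rw [realize_mk, realize_mk]
  exact Quotient.sound (PresCong.of_identity hp σ)

theorem realize_eq_of_presCong {C : Type*} [L.Structure C] (hC : InVariety E C) (x : X → C)
    (hx : ∀ s t, rel s t → s.realize x = t.realize x) {s t : L.Term X}
    (h : PresCong E rel s t) : s.realize x = t.realize x := by
  induction h with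
  | of_rel h => exact hx _ _ h
  | of_identity hp σ => rw [Term.realize_subst, Term.realize_subst]; exact hC _ hp _
  | refl => rfl
  | symm _ ih => exact ih.symm
  | trans _ _ ih₁ ih₂ => exact ih₁.trans ih₂
  | func f _ ih => simp only [Term.realize_func, ih]

/-- The homomorphism to an algebra `C` of the variety given by an assignment of the generators
that satisfies the defining relations. -/
noncomputable def lift {C : Type*} [L.Structure C] (hC : InVariety E C) (x : X → C)
    (hx : ∀ s t, rel s t → s.realize x = t.realize x) : Presented E rel →[L] C where
  toFun := Quotient.lift (fun t : L.Term X => t.realize x)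
    fun _ _ h => realize_eq_of_presCong hC x hx h
  map_fun' {n} f a := by
    choose t ht using fun i => mk_surjective (a i)
    obtain rfl : (fun i => mk (t i)) = a := funext ht
    rw [funMap_mk]
    rfl
  map_rel' r := isEmptyElim r

@[simp] theorem lift_mk {C : Type*} [L.Structure C] (hC : InVariety E C) (x : X → C)
    (hx : ∀ s t, rel s t → s.realize x = t.realize x) (t : L.Term X) :
    lift hC x hx (mk t) = t.realize x := rfl

theorem hom_ext {C : Type*} [L.Structure C] {φ ψ : Presented E rel →[L] C}
    (h : ∀ x, φ (mk (Term.var x)) = ψ (mk (Term.var x))) : φ = ψ := by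
  ext a
  obtain ⟨t, rfl⟩ := mk_surjective a
  induction t with
  | var x => exact h x
  | func f ts ih =>
    rw [← funMap_mk, Hom.map_fun, Hom.map_fun]
    exact congrArg (funMap f) (funext ih)

end Presented

variable (E)

/-- The free algebra of the variety defined by `E`, freely generated by `X`. -/
abbrev FreeAlg (X : Type w) : Type (max u w) :=
  Presented E (fun _ _ : L.Term X => False)

/-- The homomorphism from the free algebra extending an assignment of the free generators. -/
noncomputable def FreeAlg.lift {E : Set (Identity L)} {X : Type w} {C : Type*} [L.Structure C]
    (hC : InVariety E C) (x : X → C) : FreeAlg E X →[L] C :=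
  Presented.lift hC x fun _ _ h => h.elim

/-- The multiplication tables of `A` and `B`, as relations between terms over `A ⊕ B`. -/
inductive CoprodRel (A : Type*) (B : Type*) [L.Structure A] [L.Structure B] :
    L.Term (A ⊕ B) → L.Term (A ⊕ B) → Prop
  | left {n : ℕ} (f : L.Functions n) (a : Fin n → A) :
      CoprodRel A B (Term.func f fun i => Term.var (Sum.inl (a i)))
        (Term.var (Sum.inl (funMap f a)))
  | right {n : ℕ} (f : L.Functions n) (b : Fin n → B) :
      CoprodRel A B (Term.func f fun i => Term.var (Sum.inr (b i)))
        (Term.var (Sum.inr (funMap f b)))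

/-- The coproduct (free product) of `A` and `B` in the variety defined by `E`. -/
abbrev Coprod (A : Type*) (B : Type*) [L.Structure A] [L.Structure B] :=
  Presented E (CoprodRel (L := L) A B)

namespace Coprod

variable (A : Type*) (B : Type*) [L.Structure A] [L.Structure B]

/-- The canonical homomorphism from the first factor. -/
noncomputable def inl : A →[L] Coprod E A B where
  toFun a := Presented.mk (Term.var (Sum.inl a))
  map_fun' f a := by
    refine Eq.trans ?_ (Presented.funMap_mk f fun i => Term.var (Sum.inl (a i))).symm
    exact Quotient.sound (PresCong.symm (PresCong.of_rel (CoprodRel.left f a)))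
  map_rel' r := isEmptyElim r

/-- The canonical homomorphism from the second factor. -/
noncomputable def inr : B →[L] Coprod E A B where
  toFun b := Presented.mk (Term.var (Sum.inr b))
  map_fun' f b := by
    refine Eq.trans ?_ (Presented.funMap_mk f fun i => Term.var (Sum.inr (b i))).symm
    exact Quotient.sound (PresCong.symm (PresCong.of_rel (CoprodRel.right f b)))
  map_rel' r := isEmptyElim r

variable {E A B}

/-- The homomorphism from the coproduct to an algebra of the variety given by homomorphisms from
the two factors. -/
noncomputable def lift {C : Type*} [L.Structure C] (hC : InVariety E C)
    (φ₁ : A →[L] C) (φ₂ : B →[L] C) : Coprod E A B →[L] C :=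
  Presented.lift hC (Sum.elim φ₁ φ₂) fun s t h => by
    cases h with
    | left f a => exact (φ₁.map_fun f a).symm
    | right f b => exact (φ₂.map_fun f b).symm

/-- The universal property of the coproduct in the variety. -/
theorem universal {C : Type*} [L.Structure C] (hC : InVariety E C)
    (φ₁ : A →[L] C) (φ₂ : B →[L] C) (φ : Coprod E A B →[L] C) :
    (φ.comp (inl E A B) = φ₁ ∧ φ.comp (inr E A B) = φ₂) ↔ φ = lift hC φ₁ φ₂ := by
  constructor
  · rintro ⟨rfl, rfl⟩
    refine Presented.hom_ext fun x => ?_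
    rcases x with a | b <;> rfl
  · rintro rfl
    exact ⟨rfl, rfl⟩

end Coprod

/-! ## Equations, zeroes, and the Zariski topology -/

variable {E} {A : Type*} [L.Structure A]

/-- The value `f(a₁, …, aₙ)` of an element `f` of the coproduct of `A` and the free algebra on
`x₁, …, xₙ`: its image under the homomorphism to `A` that is the identity on `A` and sends each
`xᵢ` to `aᵢ`. -/
noncomputable def eval (hA : InVariety E A) {n : ℕ} (a : Fin n → A)
    (f : Coprod E A (FreeAlg E (Fin n))) : A :=
  Coprod.lift hA (Hom.id L A) (FreeAlg.lift hA a) f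

/-- The set of zeroes in `Aⁿ` of a set `S` of elements of the coproduct. -/
def zeroes [Zero A] (hA : InVariety E A) {n : ℕ} (S : Set (Coprod E A (FreeAlg E (Fin n)))) :
    Set (Fin n → A) :=
  {a | ∀ f ∈ S, eval hA a f = 0}

/-- The Zariski topology on `Aⁿ`: the coarsest topology in which every set of zeroes is closed. -/
@[reducible] def zariskiTopology [Zero A] (hA : InVariety E A) (n : ℕ) : TopologicalSpace (Fin n → A) :=
  TopologicalSpace.generateFrom
    {U | ∃ S : Set (Coprod E A (FreeAlg E (Fin n))), U = (zeroes hA S)ᶜ}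

end Presented

/-- The algebra `A` is equationally Noetherian: for every variety that contains `A` and every `n`,
the space `Aⁿ` is Noetherian in the Zariski topology. -/
def IsEquationallyNoetherian (L : FirstOrder.Language.{u, v}) [L.IsAlgebraic] (A : Type w) [L.Structure A]
    [Zero A] : Prop :=
  ∀ (E : Set (Identity L)) (hA : InVariety E A) (n : ℕ),
    @TopologicalSpace.NoetherianSpace (Fin n → A) (zariskiTopology hA n)

/-! ## Radically Noetherian rings -/

/-- A commutative ring (with trivial derivations, so that every ideal is a differential ideal) is
radically Noetherian if it satisfies the ascending chain condition for radical ideals. -/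
def IsRadicallyNoetherian (R : Type u) [CommRing R] : Prop :=
  WellFoundedGT {I : Ideal R // I.IsRadical}

/-! ## The symplectic Poisson algebra -/

/-- The operations of Poisson algebras over `R`. -/
inductive PoissonFunc (R : Type u) : ℕ → Type u
  | zero : PoissonFunc R 0
  | neg : PoissonFunc R 1
  | add : PoissonFunc R 2
  | smul (r : R) : PoissonFunc R 1
  | mul : PoissonFunc R 2
  | bracket : PoissonFunc R 2

/-- The signature of Poisson algebras over `R`. -/
def poissonLanguage (R : Type u) : FirstOrder.Language.{u, 0} where
  Functions := PoissonFunc R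
  Relations _ := Empty

instance (R : Type u) : (poissonLanguage R).IsAlgebraic := fun _ =>
  (inferInstance : IsEmpty Empty)

/-- The underlying module `R[x₁, …, x₂ₘ]` of the symplectic Poisson algebra `P_m`; the variable
`x_k` is `X (k - 1)`. -/
abbrev SymplecticPoisson (R : Type u) [CommRing R] (m : ℕ) : Type u :=
  MvPolynomial (Fin (2 * m)) R

/-- The bracket
`{f, g} = ∑ᵢ (∂f/∂x₂ᵢ₋₁ · ∂g/∂x₂ᵢ - ∂f/∂x₂ᵢ · ∂g/∂x₂ᵢ₋₁)`. -/
noncomputable def poissonBracket {R : Type u} [CommRing R] {m : ℕ}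
    (f g : SymplecticPoisson R m) : SymplecticPoisson R m :=
  ∑ i : Fin m,
    (MvPolynomial.pderiv ⟨2 * i, by omega⟩ f * MvPolynomial.pderiv ⟨2 * i + 1, by omega⟩ g -
      MvPolynomial.pderiv ⟨2 * i + 1, by omega⟩ f * MvPolynomial.pderiv ⟨2 * i, by omega⟩ g)

/-- `P_m` as an algebra of the signature of Poisson algebras over `R`. -/
noncomputable instance (R : Type u) [CommRing R] (m : ℕ) :
    (poissonLanguage R).Structure (SymplecticPoisson R m) where
  funMap {_} f :=
    match f with
    | PoissonFunc.zero => fun _ => 0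
    | PoissonFunc.neg => fun a => -a 0
    | PoissonFunc.add => fun a => a 0 + a 1
    | PoissonFunc.smul r => fun a => r • a 0
    | PoissonFunc.mul => fun a => a 0 * a 1
    | PoissonFunc.bracket => fun a => poissonBracket (a 0) (a 1)
  RelMap r _ := isEmptyElim r

end EqNoeth

/-!
The operations of `P_m`, the bracket included, are differential polynomials in their arguments for
the commuting derivations `∂/∂x₁, …, ∂/∂x₂ₘ`, so in every variety an equation over `P_m` is the
vanishing of a function on `P_mⁿ` given by a differential polynomial with coefficients in `P_m`
(`eval_mem_poissonFun`). As `P_m` is a domain of characteristic zero, the argument of the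
Ritt–Raudenbush basis theorem shows that every system of such equations is equivalent to a finite
subsystem (`exists_finite_subsystem`). By Alexander's subbasis theorem every subset of `P_mⁿ` is
then compact in the Zariski topology.

The basis theorem is proved for the algebra `D` of functions given by differential polynomials and
the prime differential ideals of functions vanishing at a point. If it fails, there is an ideal `P`
maximal among those whose zero set is not cut out by finitely many elements of `P`; it is prime,
differential, and has no nonzero constants (`IsRankedGenerated.exists_finite_subset`). Rank the
derivatives `∂^α yᵢ` and call one a leader of `P` if it is algebraic modulo `P` over the lower
ones. By Dickson's lemma finitely many leaders have all leaders among their derivatives. Take a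
polynomial of least degree for each of them, and let `H` be the product of their initials and
separants, which lie outside `P` by minimality (`IsLeader.exists_minimal`). A derivative of such a
polynomial is linear in its own leader, with initial the separant, so pseudo-division and induction
on the rank show that at every point where these polynomials vanish and `H` does not, all of `P`
vanishes (`IsRankedGenerated.exists_finite_of_isPrime`). The zeros of `P` on `H = 0` are cut out
by finitely many elements of `P` together with `H`, by maximality: a contradiction.
-/

namespace EqNoeth

open Polynomial

/-! ### Differential algebras with ranked generators -/

section Ritt

variable {A D ι V : Type*} [CommRing A] [CommRing D] [Algebra A D] [LinearOrder V]

/-- The `A`-algebra `D` with the operators `d j` is generated by the family `u`, whose index set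
`V` (the derivatives of the unknowns) is ranked: `d j` sends the constants `A` to constants and
acts on the generators through the shifts `s j : V → V`, which are strictly increasing and raise
the rank. The field `exists_finite` is Dickson's lemma for the shifts. No relations between the
generators are excluded. -/
structure IsRankedGenerated (A : Type*) {D ι V : Type*} [CommRing A] [CommRing D] [Algebra A D]
    [LinearOrder V] (u : V → D) (s : ι → V → V) (d : ι → Derivation ℤ D D) : Prop where
  map_const (j : ι) (a : A) : ∃ b : A, d j (algebraMap A D a) = algebraMap A D b
  map_gen (j : ι) (v : V) : d j (u v) = u (s j v)
  lt_shift (j : ι) (v : V) : v < s j v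
  shift_strictMono (j : ι) : StrictMono (s j)
  exists_finite (L : Set V) : ∃ L₀ ⊆ L, L₀.Finite ∧
    ∀ w ∈ L, ∃ v ∈ L₀, Relation.ReflTransGen (fun v w => ∃ j, w = s j v) v w
  adjoin_eq_top : Algebra.adjoin A (Set.range u) = ⊤

/-- The subalgebra generated by the derivatives of rank less than `v`. -/
abbrev lower (A : Type*) {D V : Type*} [CommRing A] [CommRing D] [Algebra A D] [LinearOrder V]
    (u : V → D) (v : V) : Subalgebra A D :=
  Algebra.adjoin A (u '' Set.Iio v)

variable {u : V → D} {s : ι → V → V} {d : ι → Derivation ℤ D D}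

theorem lower_mono {v w : V} (h : v ≤ w) : lower A u v ≤ lower A u w :=
  Algebra.adjoin_mono (Set.image_mono (Set.Iio_subset_Iio h))

theorem gen_mem_lower {v w : V} (h : v < w) : u v ∈ lower A u w :=
  Algebra.subset_adjoin ⟨v, h, rfl⟩

theorem aeval_mem_lower {v w : V} (h : v < w) (p : (lower A u v)[X]) :
    aeval (u v) p ∈ lower A u w := by
  rw [aeval_eq_sum_range]
  refine sum_mem fun i _ => ?_
  rw [Algebra.smul_def]
  exact mul_mem (lower_mono h.le (p.coeff i).2) (pow_mem (gen_mem_lower h) i)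

/-- An element of a subalgebra generated by derivatives is a constant or a polynomial in its
leader over the subalgebra of lower derivatives. -/
theorem mem_adjoin_image_cases {t : Set V} {g : D} (hg : g ∈ Algebra.adjoin A (u '' t)) :
    (∃ a, g = algebraMap A D a) ∨ ∃ w ∈ t, ∃ p : (lower A u w)[X], aeval (u w) p = g := by
  have hconst (w : V) (a : A) :
      ∃ p : (lower A u w)[X], aeval (u w) p = algebraMap A D a :=
    ⟨C (algebraMap A _ a), by rw [aeval_C]; rfl⟩
  have hraise {v w : V} (h : v < w) (p : (lower A u v)[X]) :
      ∃ q : (lower A u w)[X], aeval (u w) q = aeval (u v) p :=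
    ⟨C ⟨_, aeval_mem_lower h p⟩, by rw [aeval_C]; rfl⟩
  have hmax {v w : V} (hv : v ∈ t) (hw : w ∈ t) (p : (lower A u v)[X]) (q : (lower A u w)[X]) :
      ∃ x ∈ t, ∃ p' q' : (lower A u x)[X],
        aeval (u x) p' = aeval (u v) p ∧ aeval (u x) q' = aeval (u w) q := by
    rcases lt_trichotomy v w with h | rfl | h
    · obtain ⟨p', hp'⟩ := hraise h p
      exact ⟨w, hw, p', q, hp', rfl⟩
    · exact ⟨v, hv, p, q, rfl, rfl⟩
    · obtain ⟨q', hq'⟩ := hraise h q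
      exact ⟨v, hv, p, q', rfl, hq'⟩
  have hop (f : ∀ {w : V}, (lower A u w)[X] → (lower A u w)[X] → (lower A u w)[X])
      (fA : A → A → A) (fD : D → D → D)
      (hfA : ∀ a b, algebraMap A D (fA a b) = fD (algebraMap A D a) (algebraMap A D b))
      (hf : ∀ {w : V} (p q : (lower A u w)[X]),
        aeval (u w) (f p q) = fD (aeval (u w) p) (aeval (u w) q)) {x y : D}
      (hx : (∃ a, x = algebraMap A D a) ∨ ∃ w ∈ t, ∃ p : (lower A u w)[X], aeval (u w) p = x)
      (hy : (∃ a, y = algebraMap A D a) ∨ ∃ w ∈ t, ∃ p : (lower A u w)[X], aeval (u w) p = y) :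
      (∃ a, fD x y = algebraMap A D a) ∨
        ∃ w ∈ t, ∃ p : (lower A u w)[X], aeval (u w) p = fD x y := by
    rcases hx with ⟨a, rfl⟩ | ⟨v, hv, p, rfl⟩ <;> rcases hy with ⟨b, rfl⟩ | ⟨w, hw, q, rfl⟩
    · exact Or.inl ⟨fA a b, (hfA a b).symm⟩
    · obtain ⟨p, hp⟩ := hconst w a
      exact Or.inr ⟨w, hw, f p q, by rw [hf, hp]⟩
    · obtain ⟨q, hq⟩ := hconst v b
      exact Or.inr ⟨v, hv, f p q, by rw [hf, hq]⟩
    · obtain ⟨x, hx, p', q', hp, hq⟩ := hmax hv hw p q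
      exact Or.inr ⟨x, hx, f p' q', by rw [hf, hp, hq]⟩
  induction hg using Algebra.adjoin_induction with
  | mem x hx =>
    obtain ⟨w, hw, rfl⟩ := hx
    exact Or.inr ⟨w, hw, X, aeval_X _⟩
  | algebraMap a => exact Or.inl ⟨a, rfl⟩
  | add x y _ _ hx hy =>
    exact hop (fun p q => p + q) (· + ·) (· + ·) (map_add _) (fun p q => map_add _ p q) hx hy
  | mul x y _ _ hx hy =>
    exact hop (fun p q => p * q) (· * ·) (· * ·) (map_mul _) (fun p q => map_mul _ p q) hx hy


theorem IsRankedGenerated.derivation_mem_adjoin (hu : IsRankedGenerated A u s d) (j : ι)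
    {t t' : Set V} (htt : t ⊆ t') (hst : ∀ v ∈ t, s j v ∈ t') {g : D}
    (hg : g ∈ Algebra.adjoin A (u '' t)) : d j g ∈ Algebra.adjoin A (u '' t') := by
  have hle : Algebra.adjoin A (u '' t) ≤ Algebra.adjoin A (u '' t') :=
    Algebra.adjoin_mono (Set.image_mono htt)
  induction hg using Algebra.adjoin_induction with
  | mem x hx =>
    obtain ⟨v, hv, rfl⟩ := hx
    rw [hu.map_gen]
    exact Algebra.subset_adjoin ⟨_, hst v hv, rfl⟩
  | algebraMap a =>
    obtain ⟨b, hb⟩ := hu.map_const j a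
    rw [hb]
    exact algebraMap_mem _ b
  | add x y _ _ hx hy =>
    rw [map_add]
    exact add_mem hx hy
  | mul x y hx' hy' hx hy =>
    rw [Derivation.leibniz, smul_eq_mul, smul_eq_mul]
    exact add_mem (mul_mem (hle hx') hy) (mul_mem (hle hy') hx)

theorem IsRankedGenerated.derivation_mem_lower (hu : IsRankedGenerated A u s d) (j : ι) {v : V}
    {g : D} (hg : g ∈ lower A u v) : d j g ∈ lower A u (s j v) :=
  hu.derivation_mem_adjoin j (Set.Iio_subset_Iio (hu.lt_shift j v).le)
    (fun _ hw => hu.shift_strictMono j hw) hg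

/-- The derivative of a polynomial with leader `u v` is linear in the shifted leader, and the
coefficient of the shifted leader is the separant. -/
theorem IsRankedGenerated.derivation_aeval (hu : IsRankedGenerated A u s d) (j : ι) {v : V}
    (p : (lower A u v)[X]) : ∃ T ∈ lower A u (s j v),
      d j (aeval (u v) p) = aeval (u v) (derivative p) * u (s j v) + T := by
  induction p using Polynomial.induction_on' with
  | add p q hp hq =>
    obtain ⟨T, hT, hpT⟩ := hp
    obtain ⟨T', hT', hqT⟩ := hq
    refine ⟨T + T', add_mem hT hT', ?_⟩
    simp only [map_add, hpT, hqT]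
    ring
  | monomial n c =>
    refine ⟨u v ^ n * d j c, mul_mem (pow_mem (gen_mem_lower (hu.lt_shift j v)) n)
      (hu.derivation_mem_lower j c.2), ?_⟩
    have hc : algebraMap (lower A u v) D c = c := rfl
    simp only [aeval_monomial, derivative_monomial, hc, Derivation.leibniz,
      Derivation.leibniz_pow, hu.map_gen, smul_eq_mul, map_mul, map_natCast, nsmul_eq_mul]
    ring

/-- Every proper derivative of a polynomial `aeval (u v) p` with leader `u v` is linear in its
leader `u w`, with initial the separant of `p`. -/
theorem IsRankedGenerated.exists_linear_mem (hu : IsRankedGenerated A u s d) {J : Ideal D}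
    (hJ : ∀ j, ∀ f ∈ J, d j f ∈ J) {v w : V} (p : (lower A u v)[X]) (hp : aeval (u v) p ∈ J)
    (hvw : Relation.ReflTransGen (fun v w => ∃ j, w = s j v) v w) :
    w = v ∨ v < w ∧ ∃ T ∈ lower A u w, aeval (u v) (derivative p) * u w + T ∈ J := by
  induction hvw with
  | refl => exact Or.inl rfl
  | @tail w w' _ h ih =>
    obtain ⟨j, rfl⟩ := h
    right
    rcases ih with rfl | ⟨hlt, T, hT, hTJ⟩
    · obtain ⟨T, hT, h⟩ := hu.derivation_aeval j p
      exact ⟨hu.lt_shift j _, T, hT, h ▸ hJ j _ hp⟩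
    · refine ⟨hlt.trans (hu.lt_shift j w),
        u w * d j (aeval (u v) (derivative p)) + d j T, ?_, ?_⟩
      · refine add_mem (mul_mem (gen_mem_lower (hu.lt_shift j w)) ?_)
          (hu.derivation_mem_lower j hT)
        exact hu.derivation_mem_lower j (aeval_mem_lower hlt _)
      · have h := hJ j _ hTJ
        rw [map_add, Derivation.leibniz, hu.map_gen, smul_eq_mul, smul_eq_mul, add_assoc] at h
        exact h

/-- Pseudo-division by `f`, evaluated at `x`: if the prime ideal `Q` contains `f(x)` but not the
initial of `f`, then membership in `Q` of the values `p(x) ∈ P` has to be checked only for `p` of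
degree less than that of `f`. -/
theorem aeval_mem_of_pseudoDivision {B : Subalgebra A D} {x : D} {P Q : Ideal D} [Q.IsPrime]
    {f : B[X]} (hlc : (f.leadingCoeff : D) ∉ Q) (hfP : aeval x f ∈ P) (hfQ : aeval x f ∈ Q)
    (hlow : ∀ p : B[X], p.degree < f.degree → aeval x p ∈ P → aeval x p ∈ Q) (p : B[X])
    (hp : aeval x p ∈ P) : aeval x p ∈ Q := by
  induction hn : p.degree using WellFoundedLT.induction generalizing p with
  | ind n ih =>
    subst hn
    rcases lt_or_ge p.degree f.degree with h | h
    · exact hlow p h hp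
    have hp0 : p ≠ 0 := by
      rintro rfl
      rw [degree_zero, le_bot_iff, degree_eq_bot] at h
      simp [h] at hlc
    set q : B[X] := C f.leadingCoeff * p -
      C p.leadingCoeff * X ^ (p.natDegree - f.natDegree) * f with hq
    have hqe : aeval x q = f.leadingCoeff * aeval x p -
        p.leadingCoeff * x ^ (p.natDegree - f.natDegree) * aeval x f := by
      simp only [hq, map_sub, map_mul, map_pow, aeval_C, aeval_X]
      rfl
    have hqP : aeval x q ∈ P := by
      rw [hqe]
      exact sub_mem (P.mul_mem_left _ hp) (P.mul_mem_left _ hfP)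
    have hqd : q.degree < p.degree := by
      rw [degree_eq_natDegree hp0, degree_lt_iff_coeff_zero]
      intro k hk
      have hfk : f.natDegree ≤ p.natDegree := natDegree_le_natDegree h
      have hkd : p.natDegree - f.natDegree ≤ k := by omega
      rw [hq, coeff_sub, coeff_C_mul, mul_assoc, coeff_C_mul, coeff_X_pow_mul', if_pos hkd]
      rcases hk.eq_or_lt with rfl | hk
      · rw [Nat.sub_sub_self hfk, coeff_natDegree, coeff_natDegree, mul_comm, sub_self]
      · rw [coeff_eq_zero_of_natDegree_lt hk, coeff_eq_zero_of_natDegree_lt (by omega)]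
        simp
    have hqQ := ih _ hqd q hqP rfl
    rw [hqe] at hqQ
    have h1 : (f.leadingCoeff : D) * aeval x p ∈ Q := by
      have := add_mem hqQ (Q.mul_mem_left
        ((p.leadingCoeff : D) * x ^ (p.natDegree - f.natDegree)) hfQ)
      simpa using this
    exact (‹Q.IsPrime›.mem_or_mem h1).resolve_left hlc

/-- The derivative `u v` is algebraic modulo `P` over the lower derivatives. -/
def IsLeader (A : Type*) {D V : Type*} [CommRing A] [CommRing D] [Algebra A D] [LinearOrder V]
    (u : V → D) (P : Ideal D) (v : V) : Prop :=
  ∃ p : (lower A u v)[X], aeval (u v) p ∈ P ∧ ∃ i, (p.coeff i : D) ∉ P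

/-- A polynomial of least degree witnessing that `v` is a leader of the prime ideal `P` has
initial and separant outside `P`; the separant uses that `P` contains no nonzero integers. -/
theorem IsLeader.exists_minimal {P : Ideal D} [P.IsPrime] (hP : ∀ n : ℕ, (n : D) ∈ P → n = 0)
    {v : V} (hv : IsLeader A u P v) : ∃ f : (lower A u v)[X], aeval (u v) f ∈ P ∧
      (f.leadingCoeff : D) ∉ P ∧ aeval (u v) (derivative f) ∉ P ∧
      ∀ p : (lower A u v)[X], p.degree < f.degree → aeval (u v) p ∈ P →
        ∀ i, (p.coeff i : D) ∈ P := by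
  classical
  have hex : ∃ n, ∃ p : (lower A u v)[X],
      p.natDegree = n ∧ aeval (u v) p ∈ P ∧ ∃ i, (p.coeff i : D) ∉ P := by
    obtain ⟨p, hp⟩ := hv
    exact ⟨_, p, rfl, hp⟩
  obtain ⟨f, hfn, hfP, i, hi⟩ := Nat.find_spec hex
  have hmin (p : (lower A u v)[X]) (hpd : p.natDegree < f.natDegree) (hp : aeval (u v) p ∈ P)
      (i : ℕ) : (p.coeff i : D) ∈ P := by
    by_contra h
    exact Nat.find_min hex (hfn ▸ hpd) ⟨p, rfl, hp, i, h⟩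
  have hlc : (f.leadingCoeff : D) ∉ P := by
    intro hlc
    have he : aeval (u v) f.eraseLead ∈ P := by
      have hs := congrArg (aeval (u v)) f.eraseLead_add_C_mul_X_pow
      simp only [map_add, map_mul, map_pow, aeval_C, aeval_X] at hs
      rw [eq_sub_of_add_eq hs]
      exact sub_mem hfP (P.mul_mem_right _ hlc)
    have hin : i ≠ f.natDegree := by
      rintro rfl
      exact hi hlc
    rw [← eraseLead_coeff_of_ne _ hin] at hi
    rcases f.eraseLead_natDegree_lt_or_eraseLead_eq_zero with h | h
    · exact hi (hmin _ h he i)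
    · simp [h] at hi
  have hdeg : f.natDegree ≠ 0 := by
    intro h0
    rw [eq_C_of_natDegree_eq_zero h0] at hfP hlc
    rw [aeval_C] at hfP
    rw [leadingCoeff_C] at hlc
    exact hlc hfP
  refine ⟨f, hfP, hlc, fun hsep => ?_, fun p hp => hmin p ?_⟩
  · have h := hmin _ (natDegree_derivative_lt hdeg) hsep (f.natDegree - 1)
    rw [coeff_derivative, Nat.sub_add_cancel (Nat.one_le_iff_ne_zero.mpr hdeg),
      ← Nat.cast_succ, Nat.succ_eq_add_one, Nat.sub_add_cancel (Nat.one_le_iff_ne_zero.mpr hdeg)]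
      at h
    rcases ‹P.IsPrime›.mem_or_mem (x := (f.leadingCoeff : D)) (y := (f.natDegree : D))
      (by simpa using h) with h | h
    · exact hlc h
    · exact hdeg (hP _ h)
  · rcases eq_or_ne p 0 with rfl | hp0
    · rw [natDegree_zero]
      exact hdeg.bot_lt
    · exact natDegree_lt_natDegree hp0 hp

/-- A prime differential ideal `P` without nonzero constants is determined, off the zeros of one
element `H ∉ P`, by finitely many of its elements: the minimal-degree polynomials of the finitely
many leaders that generate all leaders under differentiation; `H` is the product of their initials
and separants. -/
theorem IsRankedGenerated.exists_finite_of_isPrime [CharZero A] [WellFoundedLT V]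
    (hu : IsRankedGenerated A u s d) {P : Ideal D} [P.IsPrime] (hPd : ∀ j, ∀ f ∈ P, d j f ∈ P)
    (hPA : ∀ a, algebraMap A D a ∈ P → a = 0) :
    ∃ T : Set D, T.Finite ∧ T ⊆ P ∧ ∃ H ∉ P, ∀ Q : Ideal D, Q.IsPrime →
      (∀ j, ∀ f ∈ Q, d j f ∈ Q) → T ⊆ Q → H ∉ Q → P ≤ Q := by
  have hPn (n : ℕ) (hn : (n : D) ∈ P) : n = 0 := by
    rw [← map_natCast (algebraMap A D)] at hn
    exact_mod_cast hPA _ hn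
  obtain ⟨L₀, hL₀, hfin, hreach⟩ := hu.exists_finite {v | IsLeader A u P v}
  have hmin (v : V) : ∃ f : (lower A u v)[X], v ∈ L₀ → aeval (u v) f ∈ P ∧
      (f.leadingCoeff : D) ∉ P ∧ aeval (u v) (derivative f) ∉ P ∧
      ∀ p : (lower A u v)[X], p.degree < f.degree → aeval (u v) p ∈ P →
        ∀ i, (p.coeff i : D) ∈ P := by
    by_cases hv : v ∈ L₀
    · obtain ⟨f, hf⟩ := (hL₀ hv : IsLeader A u P v).exists_minimal hPn
      exact ⟨f, fun _ => hf⟩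
    · exact ⟨0, fun h => absurd h hv⟩
  choose f hf using hmin
  refine ⟨(fun v => aeval (u v) (f v)) '' L₀, hfin.image _, ?_,
    ∏ v ∈ hfin.toFinset, ((f v).leadingCoeff : D) * aeval (u v) (derivative (f v)), ?_, ?_⟩
  · rintro _ ⟨v, hv, rfl⟩
    exact (hf v hv).1
  · rw [Ideal.IsPrime.prod_mem_iff]
    rintro ⟨v, hv, h⟩
    have hv := hf v (hfin.mem_toFinset.mp hv)
    exact (‹P.IsPrime›.mem_or_mem h).elim hv.2.1 hv.2.2.1
  intro Q hQ hQd hTQ hHQ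
  have hlcQ (v : V) (hv : v ∈ L₀) : ((f v).leadingCoeff : D) ∉ Q := fun h =>
    hHQ <| Ideal.IsPrime.prod_mem_iff.mpr
      ⟨v, hfin.mem_toFinset.mpr hv, Q.mul_mem_right _ h⟩
  have hsepQ (v : V) (hv : v ∈ L₀) : aeval (u v) (derivative (f v)) ∉ Q := fun h =>
    hHQ <| Ideal.IsPrime.prod_mem_iff.mpr
      ⟨v, hfin.mem_toFinset.mpr hv, Q.mul_mem_left _ h⟩
  have hconst (a : A) (ha : algebraMap A D a ∈ P) : algebraMap A D a ∈ Q := by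
    rw [hPA a ha, map_zero]
    exact zero_mem _
  -- Induction on the leader: elements of `P` with leader `u w` belong to `Q`.
  have key (w : V) : ∀ p : (lower A u w)[X], aeval (u w) p ∈ P → aeval (u w) p ∈ Q := by
    induction w using WellFoundedLT.induction with
    | ind w ih =>
      have hlow (g : D) (hg : g ∈ lower A u w) (hgP : g ∈ P) : g ∈ Q := by
        rcases mem_adjoin_image_cases hg with ⟨a, rfl⟩ | ⟨w', hw', p, rfl⟩
        · exact hconst a hgP
        · exact ih w' hw' p hgP
      have hcoeff (p : (lower A u w)[X]) (hp : ∀ i, (p.coeff i : D) ∈ P) : aeval (u w) p ∈ Q := by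
        rw [aeval_eq_sum_range]
        refine sum_mem fun i _ => ?_
        rw [Algebra.smul_def]
        exact Q.mul_mem_right _ (hlow _ (p.coeff i).2 (hp i))
      intro p hp
      by_cases hw : IsLeader A u P w
      · obtain ⟨v, hv, hvw⟩ := hreach w hw
        have hfQ : aeval (u v) (f v) ∈ Q := hTQ ⟨v, hv, rfl⟩
        rcases hu.exists_linear_mem (J := P ⊓ Q) (fun j g hg => ⟨hPd j g hg.1, hQd j g hg.2⟩)
          (f v) ⟨(hf v hv).1, hfQ⟩ hvw with rfl | ⟨hlt, T, hT, hTP, hTQ'⟩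
        · exact aeval_mem_of_pseudoDivision (hlcQ w hv) (hf w hv).1 hfQ
            (fun q hq hqP => hcoeff q ((hf w hv).2.2.2 q hq hqP)) p hp
        · set S : lower A u w := ⟨aeval (u v) (derivative (f v)), aeval_mem_lower hlt _⟩ with hS
          have hS0 : S ≠ 0 := fun h => hsepQ v hv (by
            have : (S : D) = 0 := by rw [h]; rfl
            rw [hS] at this
            simp only at this
            rw [this]
            exact zero_mem _)
          have he : aeval (u w) (C S * X + C ⟨T, hT⟩ : (lower A u w)[X]) =
              aeval (u v) (derivative (f v)) * u w + T := by
            simp only [map_add, map_mul, aeval_C, aeval_X]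
            rfl
          refine aeval_mem_of_pseudoDivision (f := C S * X + C ⟨T, hT⟩) (P := P) ?_ ?_ ?_ ?_ p hp
          · rw [leadingCoeff_linear hS0]
            exact hsepQ v hv
          · rw [he]
            exact hTP
          · rw [he]
            exact hTQ'
          · intro q hq hqP
            rw [degree_linear hS0, ← Nat.cast_one, degree_lt_iff_coeff_zero] at hq
            rw [eq_C_of_degree_le_zero ((degree_le_iff_coeff_zero q 0).mpr fun m hm =>
              hq m (by exact_mod_cast hm))] at hqP ⊢
            rw [aeval_C] at hqP ⊢
            exact hlow _ (q.coeff 0).2 hqP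
      · exact hcoeff p (by
          by_contra! h
          exact hw ⟨p, hp, h⟩)
  intro g hg
  have hgt : g ∈ Algebra.adjoin A (u '' Set.univ) := by
    rw [Set.image_univ, hu.adjoin_eq_top]
    trivial
  rcases mem_adjoin_image_cases hgt with ⟨a, rfl⟩ | ⟨w, -, p, rfl⟩
  · exact hconst a hg
  · exact key w p hg

/-- The Ritt–Raudenbush basis theorem, for the differential ideals that are intersections of a
given family `Q` of prime differential ideals without nonzero constants (for instance the ideals
of elements vanishing at a point): every `S` has the same zeros as a finite subset. -/
theorem IsRankedGenerated.exists_finite_subset [CharZero A] [WellFoundedLT V]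
    (hu : IsRankedGenerated A u s d) {X : Type*} (Q : X → Ideal D) (hQ : ∀ x, (Q x).IsPrime)
    (hQd : ∀ x j, ∀ f ∈ Q x, d j f ∈ Q x) (hQA : ∀ x a, algebraMap A D a ∈ Q x → a = 0)
    (S : Set D) : ∃ T ⊆ S, T.Finite ∧ ∀ x, T ⊆ Q x → S ⊆ Q x := by
  suffices hgood : ∀ J : Ideal D, ∃ T ⊆ (J : Set D), T.Finite ∧ ∀ x, T ⊆ Q x → J ≤ Q x by
    obtain ⟨T, hTS, hT, h⟩ := hgood (Ideal.span S)
    obtain ⟨T', hT'S, hT'⟩ := Submodule.subset_span_finite_of_subset_span (t := hT.toFinset)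
      (by simpa using hTS)
    refine ⟨T', hT'S, T'.finite_toSet, fun x hx => Ideal.span_le.mp (h x ?_)⟩
    refine subset_trans ?_ (SetLike.coe_subset_coe.mpr (Ideal.span_le.mpr hx))
    simpa using hT'
  by_contra! hbad
  -- Finite subsets of `J ⊔ (g)` may be taken of the form `T ∪ {g}` with `T ⊆ J`.
  have hsup {J : Ideal D} {g : D} (h : ∃ T ⊆ ((J ⊔ Ideal.span {g} : Ideal D) : Set D),
      T.Finite ∧ ∀ x, T ⊆ Q x → J ⊔ Ideal.span {g} ≤ Q x) :
      ∃ T ⊆ (J : Set D), T.Finite ∧ ∀ x, T ⊆ Q x → g ∈ Q x → J ≤ Q x := by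
    obtain ⟨T, hTJ, hT, h⟩ := h
    have hdec (t : D) : ∃ a ∈ J, t ∈ T → ∃ b, t = a + b * g := by
      by_cases ht : t ∈ T
      · obtain ⟨a, ha, c, hc, rfl⟩ := Submodule.mem_sup.mp (hTJ ht)
        obtain ⟨b, rfl⟩ := Ideal.mem_span_singleton'.mp hc
        exact ⟨a, ha, fun _ => ⟨b, rfl⟩⟩
      · exact ⟨0, zero_mem _, fun h => absurd h ht⟩
    choose a ha hab using hdec
    refine ⟨a '' T, ?_, hT.image _, fun x hx hg => le_sup_left.trans (h x fun t ht => ?_)⟩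
    · rintro _ ⟨t, -, rfl⟩
      exact ha t
    · obtain ⟨b, hb⟩ := hab t ht
      rw [hb]
      exact add_mem (hx ⟨t, ht, rfl⟩) (Ideal.mul_mem_left _ _ hg)
  obtain ⟨J₀, hJ₀⟩ := hbad
  obtain ⟨P, -, hP⟩ := zorn_le_nonempty₀
    {J : Ideal D | ∀ T ⊆ (J : Set D), T.Finite → ∃ x, T ⊆ Q x ∧ ¬ J ≤ Q x} (by
      intro c hc hchain J hJ
      refine ⟨sSup c, ?_, fun I hI => le_sSup hI⟩
      intro T hT hfin
      obtain ⟨I, hI, hTI⟩ : ∃ I ∈ c, T ⊆ (I : Set D) := by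
        obtain ⟨I, hI, hTI⟩ := DirectedOn.exists_mem_subset_of_finset_subset_biUnion
          (f := fun I : Ideal D => (I : Set D)) ⟨J, hJ⟩ hchain.directedOn (s := hfin.toFinset)
          (fun t ht => by
            simpa using (Submodule.mem_sSup_of_directed ⟨J, hJ⟩ hchain.directedOn).mp
              (hT (hfin.mem_toFinset.mp ht)))
        exact ⟨I, hI, by simpa using hTI⟩
      obtain ⟨x, hx, hIx⟩ := hc hI T hTI hfin
      exact ⟨x, hx, fun h => hIx ((le_sSup hI).trans h)⟩) J₀ hJ₀
  have hPbad := hP.prop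
  -- By maximality, `P` together with any further element has a finite basis.
  have hmax {g : D} (hg : g ∉ P) :
      ∃ T ⊆ (P : Set D), T.Finite ∧ ∀ x, T ⊆ Q x → g ∈ Q x → P ≤ Q x := by
    refine hsup ?_
    by_contra! h
    exact hg (hP.le_of_ge h le_sup_left (Ideal.mem_sup_right (Ideal.mem_span_singleton_self g)))
  have hprime : P.IsPrime := by
    refine ⟨fun htop => ?_, fun {a b} hab => ?_⟩
    · obtain ⟨x, hx, -⟩ := hPbad {1} (by simp [htop]) (Set.finite_singleton 1)
      exact (hQ x).ne_top ((Ideal.eq_top_iff_one _).mpr (by simpa using hx))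
    · by_contra! h
      obtain ⟨T₁, hT₁, hfin₁, h₁⟩ := hmax h.1
      obtain ⟨T₂, hT₂, hfin₂, h₂⟩ := hmax h.2
      obtain ⟨x, hx, hPx⟩ := hPbad (insert (a * b) (T₁ ∪ T₂))
        (Set.insert_subset hab (Set.union_subset hT₁ hT₂)) ((hfin₁.union hfin₂).insert _)
      obtain ⟨hx, hx₁, hx₂⟩ := by simpa [Set.insert_subset_iff] using hx
      rcases (hQ x).mem_or_mem hx with h | h
      · exact hPx (h₁ x hx₁ h)
      · exact hPx (h₂ x hx₂ h)
  have hPd (j : ι) (f : D) (hf : f ∈ P) : d j f ∈ P := by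
    by_contra h
    obtain ⟨T, hT, hfin, h⟩ := hmax h
    obtain ⟨x, hx, hPx⟩ := hPbad (insert f T) (Set.insert_subset hf hT) (hfin.insert _)
    rw [Set.insert_subset_iff] at hx
    exact hPx (h x hx.2 (hQd x j f hx.1))
  have hPA (a : A) (ha : algebraMap A D a ∈ P) : a = 0 := by
    obtain ⟨x, hx, -⟩ := hPbad {algebraMap A D a} (by simpa using ha) (Set.finite_singleton _)
    exact hQA x a (by simpa using hx)
  obtain ⟨T, hfin, hT, H, hH, hPQ⟩ := hu.exists_finite_of_isPrime hPd hPA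
  obtain ⟨T', hT', hfin', h⟩ := hmax hH
  obtain ⟨x, hx, hPx⟩ := hPbad (T ∪ T') (Set.union_subset hT hT') (hfin.union hfin')
  rw [Set.union_subset_iff] at hx
  by_cases hHx : H ∈ Q x
  · exact hPx (h x hx.2 hHx)
  · exact hPx (hPQ (Q x) (hQ x) (hQd x) hx.1 hHx)

end Ritt

/-! ### Functions given by differential polynomials -/

section DiffPoly

/-- The derivatives `∂^α yᵢ` of unknowns `y₁, …, yₙ` under `k` operators, encoded by the pairs
`(α, i)` and ranked first by `α` in the degree-lexicographic order, then by `i`. -/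
abbrev DerivIndex (k n : ℕ) : Type := DegLex (Fin k →₀ ℕ) ×ₗ Fin n

/-- The effect of `∂ⱼ` on the derivative `∂^α yᵢ`. -/
noncomputable def DerivIndex.shift {k n : ℕ} (j : Fin k) (v : DerivIndex k n) : DerivIndex k n :=
  toLex ((ofLex v).1 + toDegLex (Finsupp.single j 1), (ofLex v).2)

theorem DerivIndex.shift_strictMono {k n : ℕ} (j : Fin k) :
    StrictMono (shift (n := n) j) := by
  intro v w h
  rw [Prod.Lex.lt_iff] at h ⊢
  rcases h with h | ⟨h, h'⟩
  · exact Or.inl (add_lt_add_left h _)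
  · exact Or.inr ⟨congrArg (· + _) h, h'⟩

theorem DerivIndex.lt_shift {k n : ℕ} (j : Fin k) (v : DerivIndex k n) : v < shift j v := by
  rw [Prod.Lex.lt_iff]
  refine Or.inl (lt_add_of_pos_right _ ?_)
  rw [Finsupp.DegLex.lt_iff]
  left
  change (0 : Fin k →₀ ℕ).degree < (Finsupp.single j 1).degree
  simp

theorem DerivIndex.reflTransGen_shift {k n : ℕ} (α β : Fin k →₀ ℕ) (i : Fin n) :
    Relation.ReflTransGen (fun v w => ∃ j, w = shift j v)
      (toLex (toDegLex α, i) : DerivIndex k n) (toLex (toDegLex (α + β), i)) := by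
  induction hm : β.degree generalizing β with
  | zero =>
    rw [Finsupp.degree_eq_zero_iff] at hm
    rw [hm, add_zero]
  | succ m ih =>
    obtain ⟨j, hj⟩ : ∃ j, β j ≠ 0 := by
      by_contra! h
      have : β = 0 := Finsupp.ext h
      simp [this] at hm
    have hβ : β - Finsupp.single j 1 + Finsupp.single j 1 = β :=
      tsub_add_cancel_of_le (by simpa [Nat.one_le_iff_ne_zero] using hj)
    refine (ih (β - Finsupp.single j 1) ?_).tail ⟨j, ?_⟩
    · rw [← hβ, map_add, Finsupp.degree_single] at hm
      exact Nat.succ_injective hm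
    · conv_lhs => rw [← hβ, ← add_assoc]
      rfl

/-- Dickson's lemma: all derivatives in `L` are derivatives of finitely many of them. -/
theorem DerivIndex.exists_finite {k n : ℕ} (L : Set (DerivIndex k n)) :
    ∃ L₀ ⊆ L, L₀.Finite ∧
      ∀ w ∈ L, ∃ v ∈ L₀, Relation.ReflTransGen (fun v w => ∃ j, w = shift j v) v w := by
  let M (i : Fin n) : Set (Fin k →₀ ℕ) := {α | toLex (toDegLex α, i) ∈ L}
  refine ⟨⋃ i, (fun α => toLex (toDegLex α, i)) '' {α | Minimal (· ∈ M i) α}, ?_, ?_, ?_⟩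
  · rintro _ hv
    obtain ⟨i, α, hα, rfl⟩ := Set.mem_iUnion.mp hv
    exact hα.prop
  · exact Set.finite_iUnion fun i => (WellQuasiOrderedLE.finite_of_isAntichain
      (setOfPred_minimal_antichain (· ∈ M i))).image _
  · intro w hw
    obtain ⟨α, hle, hα⟩ := (Set.isPWO_of_wellQuasiOrderedLE (M (ofLex w).2)).exists_le_minimal
      (a := ofDegLex (ofLex w).1) hw
    refine ⟨_, Set.mem_iUnion.mpr ⟨(ofLex w).2, α, hα, rfl⟩, ?_⟩
    have h := reflTransGen_shift α (ofDegLex (ofLex w).1 - α) (ofLex w).2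
    rwa [add_tsub_cancel_of_le hle] at h

variable {A : Type*} [CommRing A] {k : ℕ} (δ : Fin k → Derivation ℤ A A)

/-- The differential operators `∂^α` of commuting derivations; the exponents are written
multiplicatively. -/
noncomputable def iterDeriv (hδ : ∀ i j a, δ i (δ j a) = δ j (δ i a)) :
    (Fin k → Multiplicative ℕ) →* Module.End ℤ A :=
  MonoidHom.noncommPiCoprod (fun j => powersHom (Module.End ℤ A) (δ j : A →ₗ[ℤ] A))
    fun i j _ x y => by
      rw [powersHom_apply, powersHom_apply]
      exact Commute.pow_pow (LinearMap.ext (hδ i j)) _ _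

theorem iterDeriv_mulSingle (hδ : ∀ i j a, δ i (δ j a) = δ j (δ i a)) (j : Fin k) (a : A) :
    iterDeriv δ hδ (Pi.mulSingle j (Multiplicative.ofAdd 1)) a = δ j a := by
  refine (LinearMap.congr_fun (MonoidHom.noncommPiCoprod_mulSingle _ j _) a).trans ?_
  rw [powersHom_apply, toAdd_ofAdd, pow_one]
  rfl

/-- The function `a ↦ ∂^α aᵢ` on `Aⁿ`, for `v = (α, i)`. -/
noncomputable def derivCoord (hδ : ∀ i j a, δ i (δ j a) = δ j (δ i a)) {n : ℕ}
    (v : DerivIndex k n) (a : Fin n → A) : A :=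
  iterDeriv δ hδ (fun j => Multiplicative.ofAdd (ofDegLex (ofLex v).1 j)) (a (ofLex v).2)

theorem derivCoord_zero (hδ : ∀ i j a, δ i (δ j a) = δ j (δ i a)) {n : ℕ} (i : Fin n) :
    derivCoord δ hδ (toLex (toDegLex 0, i)) = fun a => a i := by
  funext a
  exact LinearMap.congr_fun (map_one (iterDeriv δ hδ)) (a i)

theorem derivCoord_shift (hδ : ∀ i j a, δ i (δ j a) = δ j (δ i a)) {n : ℕ} (j : Fin k)
    (v : DerivIndex k n) (a : Fin n → A) :
    derivCoord δ hδ (v.shift j) a = δ j (derivCoord δ hδ v a) := by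
  rw [← iterDeriv_mulSingle δ hδ]
  simp only [derivCoord]
  rw [← Module.End.mul_apply, ← map_mul]
  congr 2
  funext i
  rcases eq_or_ne i j with rfl | h
  · simp [DerivIndex.shift, ofDegLex_add, mul_comm]
  · simp [DerivIndex.shift, ofDegLex_add, h]

/-- The algebra of functions `Aⁿ → A` given by differential polynomials with coefficients
in `A`. -/
noncomputable def diffPolyFun (hδ : ∀ i j a, δ i (δ j a) = δ j (δ i a)) (n : ℕ) :
    Subalgebra A ((Fin n → A) → A) :=
  Algebra.adjoin A (Set.range (derivCoord δ hδ (n := n)))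

variable {δ} {hδ : ∀ i j a, δ i (δ j a) = δ j (δ i a)} {n : ℕ}

theorem derivation_comp_mem (j : Fin k) {f : (Fin n → A) → A} (hf : f ∈ diffPolyFun δ hδ n) :
    (fun a => δ j (f a)) ∈ diffPolyFun δ hδ n := by
  induction hf using Algebra.adjoin_induction with
  | mem f hf =>
    obtain ⟨v, rfl⟩ := hf
    exact Algebra.subset_adjoin ⟨v.shift j, funext (derivCoord_shift δ hδ j v)⟩
  | algebraMap c => exact algebraMap_mem (diffPolyFun δ hδ n) (δ j c)
  | add f g _ _ hf hg =>
    convert add_mem hf hg using 1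
    funext a
    exact map_add _ _ _
  | mul f g hf' hg' hf hg =>
    have h : (fun a => δ j ((f * g) a)) =
        f * (fun a => δ j (g a)) + g * (fun a => δ j (f a)) :=
      funext fun a => (δ j).leibniz _ _
    rw [h]
    exact add_mem (mul_mem hf' hg) (mul_mem hg' hf)

/-- The pointwise derivation on functions given by differential polynomials. -/
noncomputable def diffPolyDeriv (hδ : ∀ i j a, δ i (δ j a) = δ j (δ i a)) (n : ℕ) (j : Fin k) :
    Derivation ℤ (diffPolyFun δ hδ n) (diffPolyFun δ hδ n) :=
  Derivation.mk'
    (AddMonoidHom.toIntLinearMap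
      { toFun := fun f => ⟨fun a => δ j (f.1 a), derivation_comp_mem j f.2⟩
        map_zero' := Subtype.ext (funext fun _ => map_zero (δ j))
        map_add' := fun _ _ => Subtype.ext (funext fun _ => map_add (δ j) _ _) })
    fun _ _ => Subtype.ext (funext fun _ => (δ j).leibniz _ _)

theorem isRankedGenerated_diffPolyFun (hδ : ∀ i j a, δ i (δ j a) = δ j (δ i a)) (n : ℕ) :
    IsRankedGenerated A
      (fun v => (⟨derivCoord δ hδ v, Algebra.subset_adjoin ⟨v, rfl⟩⟩ : diffPolyFun δ hδ n))
      DerivIndex.shift (diffPolyDeriv hδ n) where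
  map_const j c := ⟨δ j c, rfl⟩
  map_gen j v := Subtype.ext (funext fun a => (derivCoord_shift δ hδ j v a).symm)
  lt_shift := DerivIndex.lt_shift
  shift_strictMono := DerivIndex.shift_strictMono
  exists_finite := DerivIndex.exists_finite
  adjoin_eq_top := by
    rw [eq_top_iff]
    refine (Algebra.adjoin_adjoin_coe_preimage (R := A)
      (s := Set.range (derivCoord δ hδ (n := n)))).ge.trans (Algebra.adjoin_mono ?_)
    rintro ⟨f, hf⟩ ⟨v, hv⟩
    exact ⟨v, Subtype.ext hv⟩

/-- Every system of differential polynomial equations over a differential domain of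
characteristic zero is equivalent to a finite subsystem. -/
theorem exists_finite_subsystem [IsDomain A] [CharZero A] {S : Set ((Fin n → A) → A)}
    (hS : S ⊆ diffPolyFun δ hδ n) :
    ∃ T ⊆ S, T.Finite ∧ ∀ a, (∀ f ∈ T, f a = 0) → ∀ f ∈ S, f a = 0 := by
  let ev (a : Fin n → A) : diffPolyFun δ hδ n →+* A :=
    (Pi.evalRingHom (fun _ : Fin n → A => A) a).comp (diffPolyFun δ hδ n).val.toRingHom
  obtain ⟨T, hTS, hT, h⟩ := (isRankedGenerated_diffPolyFun hδ n).exists_finite_subset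
    (fun a => RingHom.ker (ev a)) (fun a => RingHom.ker_isPrime (ev a))
    (fun a j f hf => by
      have hf : f.1 a = 0 := hf
      change δ j (f.1 a) = 0
      rw [hf, map_zero])
    (fun _ _ hc => hc) (Subtype.val ⁻¹' S)
  refine ⟨Subtype.val '' T, ?_, hT.image _, fun a ha f hf => ?_⟩
  · rintro _ ⟨f, hf, rfl⟩
    exact hTS hf
  · exact h a (fun g hg => ha _ ⟨g, hg, rfl⟩) (show (⟨f, hS hf⟩ : diffPolyFun δ hδ n) ∈ _ from hf)

end DiffPoly

/-! ### Equations over the symplectic Poisson algebra -/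

section Poisson

variable {R : Type*} [CommRing R] {m : ℕ}

theorem pderiv_comm {σ : Type*} (i j : σ) (f : MvPolynomial σ R) :
    MvPolynomial.pderiv i (MvPolynomial.pderiv j f) =
      MvPolynomial.pderiv j (MvPolynomial.pderiv i f) := by
  classical
  have h : ⁅MvPolynomial.pderiv (R := R) i, MvPolynomial.pderiv (R := R) j⁆ = 0 := by
    refine MvPolynomial.derivation_ext fun l => ?_
    simp only [Derivation.commutator_apply, MvPolynomial.pderiv_X, Pi.single_apply]
    split_ifs <;> simp
  rw [← sub_eq_zero, ← Derivation.commutator_apply, h, Derivation.zero_apply]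

/-- The partial derivatives of `P_m`, without their linearity over `R`. -/
noncomputable def partials (R : Type*) [CommRing R] (m : ℕ) (j : Fin (2 * m)) :
    Derivation ℤ (SymplecticPoisson R m) (SymplecticPoisson R m) :=
  (MvPolynomial.pderiv j).restrictScalars ℤ

/-- The functions given by differential polynomials over `P_m`. -/
noncomputable abbrev poissonFun (R : Type*) [CommRing R] (m n : ℕ) :
    Subalgebra (SymplecticPoisson R m)
      ((Fin n → SymplecticPoisson R m) → SymplecticPoisson R m) :=
  diffPolyFun (partials R m) (fun i j => pderiv_comm i j) n

/-- The operations of Poisson algebras, applied pointwise, preserve the functions given by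
differential polynomials. -/
theorem funMap_mem_poissonFun {n l : ℕ} (F : (poissonLanguage R).Functions l)
    {f : Fin l → (Fin n → SymplecticPoisson R m) → SymplecticPoisson R m}
    (hf : ∀ i, f i ∈ poissonFun R m n) :
    (fun a => FirstOrder.Language.Structure.funMap F fun i => f i a) ∈ poissonFun R m n := by
  cases F with
  | zero => exact zero_mem _
  | neg => exact neg_mem (hf 0)
  | add => exact add_mem (hf 0) (hf 1)
  | smul r =>
    convert (poissonFun R m n).smul_mem (hf 0) (MvPolynomial.C r) using 1
    funext a
    exact MvPolynomial.smul_eq_C_mul _ _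
  | mul => exact mul_mem (hf 0) (hf 1)
  | bracket =>
    have hd (j : Fin (2 * m)) (i : Fin 2) :
        (fun a => MvPolynomial.pderiv j (f i a)) ∈ poissonFun R m n :=
      derivation_comp_mem j (hf i)
    convert sum_mem (t := Finset.univ) fun (i : Fin m) _ => sub_mem
      (mul_mem (hd ⟨2 * i, by omega⟩ 0) (hd ⟨2 * i + 1, by omega⟩ 1))
      (mul_mem (hd ⟨2 * i + 1, by omega⟩ 0) (hd ⟨2 * i, by omega⟩ 1)) using 1
    funext a
    rw [Finset.sum_apply]
    rfl

theorem realize_mem_poissonFun {n : ℕ} {Y : Type*} (t : (poissonLanguage R).Term Y)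
    {x : Y → (Fin n → SymplecticPoisson R m) → SymplecticPoisson R m}
    (hx : ∀ y, x y ∈ poissonFun R m n) :
    (fun a => t.realize fun y => x y a) ∈ poissonFun R m n := by
  induction t with
  | var y => exact hx y
  | func F ts ih => exact funMap_mem_poissonFun F ih

/-- The values of an element of the coproduct depend on the point through a differential
polynomial. -/
theorem eval_mem_poissonFun {E : Set (Identity (poissonLanguage R))}
    (hA : InVariety E (SymplecticPoisson R m)) {n : ℕ}
    (f : Coprod E (SymplecticPoisson R m) (FreeAlg E (Fin n))) :
    (fun a => eval hA a f) ∈ poissonFun R m n := by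
  obtain ⟨t, rfl⟩ := Presented.mk_surjective f
  refine realize_mem_poissonFun (x := fun y a =>
    Sum.elim (FirstOrder.Language.Hom.id (poissonLanguage R) (SymplecticPoisson R m))
      (FreeAlg.lift hA a) y) t ?_
  rintro (c | b)
  · exact algebraMap_mem (poissonFun R m n) c
  · obtain ⟨t, rfl⟩ := Presented.mk_surjective b
    refine realize_mem_poissonFun (x := fun i a => a i) t fun i => ?_
    rw [← derivCoord_zero (partials R m) (fun i j => pderiv_comm i j)]
    exact Algebra.subset_adjoin ⟨_, rfl⟩

end Poisson

end EqNoeth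

/-- The symplectic Poisson algebra `P_m` over a radically Noetherian domain containing `ℚ` is
equationally Noetherian. -/
theorem theorem6 {R : Type*} [CommRing R] [IsDomain R] [Algebra ℚ R]
    (hR : EqNoeth.IsRadicallyNoetherian R) (m : ℕ) :
    EqNoeth.IsEquationallyNoetherian (EqNoeth.poissonLanguage R)
      (EqNoeth.SymplecticPoisson R m) := by
  intro E hA n
  have : CharZero R := algebraRat.charZero R
  have : CharZero (EqNoeth.SymplecticPoisson R m) := inferInstance
  let τ := EqNoeth.zariskiTopology hA n
  refine (@TopologicalSpace.noetherianSpace_iff_isCompact _ τ).mpr fun Y => ?_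
  -- By Alexander's subbasis theorem, only covers by complements of zero sets matter.
  refine isCompact_generateFrom rfl fun P hP hYP => ?_
  -- All the equations whose nonvanishing locus belongs to the cover.
  let S : Set ((Fin n → EqNoeth.SymplecticPoisson R m) → EqNoeth.SymplecticPoisson R m) :=
    {g | g ∈ EqNoeth.poissonFun R m n ∧ ∃ U ∈ P, ∀ a, g a ≠ 0 → a ∈ U}
  have hS : S ⊆ EqNoeth.poissonFun R m n := fun g hg => hg.1
  obtain ⟨T, hTS, hT, h⟩ := EqNoeth.exists_finite_subsystem hS
  have hex (g : T) : ∃ U ∈ P, ∀ a, g.1 a ≠ 0 → a ∈ U := (hTS g.2).2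
  choose U hUP hU using hex
  have := hT.to_subtype
  refine ⟨Set.range U, Set.range_subset_iff.mpr hUP, Set.finite_range U, fun a ha => ?_⟩
  by_contra hcov
  have hzero : ∀ g ∈ T, g a = 0 := by
    intro g hg
    by_contra hga
    exact hcov ⟨U ⟨g, hg⟩, ⟨⟨g, hg⟩, rfl⟩, hU ⟨g, hg⟩ a hga⟩
  obtain ⟨W, hWP, haW⟩ := hYP ha
  obtain ⟨S', rfl⟩ := hP hWP
  refine haW fun f hf => h a hzero _ ⟨EqNoeth.eval_mem_poissonFun hA f, _, hWP, fun b hb hb0 => ?_⟩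
  exact hb (hb0 f hf)
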